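/- Let $N$ be a natural number and let $\Omega\subset\mathbb{R}^N$ be a nonempty bounded open set with Lipschitz boundary (connectedness is not assumed). Let $\omega:\Omega\times\Omega\to[0,+\infty)$ be an admissible weight function, that is, $\omega\in\mathcal{C}^1(\Omega\times\Omega)$ and $\omega(x,y)=\omega(y,x)$ for all $(x,y)\in\Omega\times\Omega$, and suppose that there is a constant $c>0$ with $c\le\omega(x,y)$ for all $(x,y)\in\Omega\times\Omega$. For $\phi\in\mathcal{C}^1_c(\Omega\times\Omega;\mathbb{R}^N)$ put $$(\mathrm{div}_\omega\phi)(x):=\int_\Omega \mathrm{div}_x\big[\omega(x,y)\,(\phi(y,x)-\phi(x,y))\big]\,\mathrm{d}y,\qquad x\in\Omega,$$ and for $u\in L^1(\Omega)$ (real valued) put $$\mathrm{NLTV}_\omega(u):=\sup\Big\{\int_\Omega u(x)\,(\mathrm{div}_\omega\phi)(x)\,\mathrm{d}x:\ \phi\in\mathcal{C}^1_c(\Omega\times\Omega;\mathbb{R}^N),\ \sup_{\Omega\times\Omega}|\phi|\le 1\Big\}\in[0,+\infty],$$ where $|\cdot|$ is the Euclidean norm. Let $\mathrm{NLBV}_\omega(\Omega):=\{u\in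 L^1(\Omega):\mathrm{NLTV}_\omega(u)<+\infty\}$, with norm $\|u\|_{\mathrm{NLBV}_\omega(\Omega)}:=\|u\|_{L^1(\Omega)}+\mathrm{NLTV}_\omega(u)$. If $(u_n)_{n\in\mathbb{N}}$ is a sequence in $\mathrm{NLBV}_\omega(\Omega)$ with $\sup_n\|u_n\|_{\mathrm{NLBV}_\omega(\Omega)}<+\infty$, then there exist a subsequence $(u_{n_k})_{k\in\mathbb{N}}$ and a function $u\in\mathrm{NLBV}_\omega(\Omega)$ such that $u_{n_k}\to u$ in $L^1(\Omega)$ as $k\to\infty$. -/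

import Mathlib

open MeasureTheory Filter Topology
open scoped ENNReal NNReal

namespace NonlocalBV

/-- The Euclidean space `ℝ^N`, with its Euclidean norm. -/
abbrev Space (N : ℕ) : Type := EuclideanSpace ℝ (Fin N)

/-- The space `L¹(Ω)` of (classes of) real-valued functions, for Lebesgue measure on `Ω`. -/
abbrev L1 {N : ℕ} (Ω : Set (Space N)) : Type := Lp ℝ 1 (volume.restrict Ω)

/-- `Ω` has Lipschitz boundary: near every boundary point `x₀`, for a suitable unit vector `v`
(the last axis of a rotated orthonormal frame), the set `Ω` is the region lying strictly above
the graph of a Lipschitz function `γ` of the remaining `N - 1` coordinates, that is, of the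
orthogonal projection to the hyperplane `vᗮ`. -/
def HasLipschitzBoundary {N : ℕ} (Ω : Set (Space N)) : Prop :=
  ∀ x₀ ∈ frontier Ω, ∃ v : Space N, ‖v‖ = 1 ∧ ∃ r : ℝ, 0 < r ∧
    ∃ (K : ℝ≥0) (γ : (Submodule.span ℝ {v})ᗮ → ℝ), LipschitzWith K γ ∧
      ∀ y ∈ Metric.ball x₀ r,
        (y ∈ Ω ↔ γ ((Submodule.span ℝ {v})ᗮ.orthogonalProjectionOnto y) < inner ℝ v y)

/-- Admissible weight functions `ω : Ω × Ω → [0, ∞)`: nonnegative, symmetric and of class `C¹`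
on `Ω × Ω`. The values of `ω` off `Ω × Ω` are irrelevant. -/
structure IsAdmissibleWeight {N : ℕ} (Ω : Set (Space N)) (ω : Space N × Space N → ℝ) :
    Prop where
  contDiffOn : ContDiffOn ℝ 1 ω (Ω ×ˢ Ω)
  nonneg : ∀ x ∈ Ω, ∀ y ∈ Ω, 0 ≤ ω (x, y)
  symm : ∀ x ∈ Ω, ∀ y ∈ Ω, ω (x, y) = ω (y, x)

/-- The divergence `∑ i, ∂F_i/∂x_i` of a vector field `F` at `x`. -/
noncomputable def divergence {N : ℕ} (F : Space N → Space N) (x : Space N) : ℝ :=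
  ∑ i : Fin N, (fderiv ℝ F x (EuclideanSpace.single i 1)) i

/-- The nonlocal divergence induced by `ω`,
`(div_ω φ)(x) = ∫_Ω div_x [ω(x, y) (φ(y, x) - φ(x, y))] dy`. -/
noncomputable def nonlocalDiv {N : ℕ} (Ω : Set (Space N)) (ω : Space N × Space N → ℝ)
    (φ : Space N × Space N → Space N) (x : Space N) : ℝ :=
  ∫ y in Ω, divergence (fun z => ω (z, y) • (φ (y, z) - φ (z, y))) x

/-- The fields `φ ∈ C¹_c(Ω × Ω; ℝ^N)` (extended by zero off `Ω × Ω`) with `‖φ‖_∞ ≤ 1`. -/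
structure IsTestField {N : ℕ} (Ω : Set (Space N)) (φ : Space N × Space N → Space N) :
    Prop where
  contDiff : ContDiff ℝ 1 φ
  hasCompactSupport : HasCompactSupport φ
  tsupport_subset : tsupport φ ⊆ Ω ×ˢ Ω
  norm_le_one : ∀ p, ‖φ p‖ ≤ 1

/-- The nonlocal total variation induced by `ω`: the supremum in `[0, ∞]` of
`∫_Ω u(x) (div_ω φ)(x) dx` over the test fields `φ`. Truncating negative values by
`ENNReal.ofReal` is harmless, because `φ = 0` is a test field, which contributes `0`. -/
noncomputable def NLTV {N : ℕ} (Ω : Set (Space N)) (ω : Space N × Space N → ℝ)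
    (u : Space N → ℝ) : ℝ≥0∞ :=
  ⨆ (φ : Space N × Space N → Space N) (_ : IsTestField Ω φ),
    ENNReal.ofReal (∫ x in Ω, u x * nonlocalDiv Ω ω φ x)

/-- The set `NLBV_ω(Ω)` of functions in `L¹(Ω)` of finite nonlocal total variation. -/
def NLBV {N : ℕ} (Ω : Set (Space N)) (ω : Space N × Space N → ℝ) : Set (L1 Ω) :=
  {u | NLTV Ω ω u < ∞}

/-- The norm `‖u‖_{L¹(Ω)} + NLTV_ω(u)` of `NLBV_ω(Ω)`, as an extended real (it is finite
exactly on `NLBV_ω(Ω)`). -/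
noncomputable def nlbvNorm {N : ℕ} (Ω : Set (Space N)) (ω : Space N × Space N → ℝ)
    (u : L1 Ω) : ℝ≥0∞ :=
  ‖u‖ₑ + NLTV Ω ω u

end NonlocalBV

namespace NonlocalBV

variable {N : ℕ}

/-! The nonlocal variation controls the ordinary total variation up to an `L¹` term; the result then
follows from BV compactness, which is proved here directly.

Fix a cutoff `η` in `Ω` with positive integral. For a local test field `ψ`, the field `φ(x,y) = -(c
η(y)/ω(x,y)) ψ(x)` is admissible because `c ≤ ω`. By symmetry the weight cancels, and the nonlocal
divergence is `c (∫η) div ψ - c ∇η · ∫ψ`. The last term costs at most a constant times the `L¹` norm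
(`nonlocalDiv_separated`, `exists_hasVariationLE_of_nlbvNorm_le`).

For compactness, the Lipschitz boundary supplies uniform interior cones, along which translates of a
BV function stay `L¹`-close to it. Averaging over a ball of directions compares `u(x)` with means of
`u` over finitely many fixed balls, so `∫_Ω |u|` is at most `ε` plus a multiple of finitely many
averages (`HasLipschitzBoundary.exists_setIntegral_abs_le`). Applied to differences, this reduces
total boundedness to finite dimensions. Lower semicontinuity puts the limit in `NLBV`. -/

/-! ### Cutoffs and `L¹` duality -/

/-- A smooth cutoff function between a compact set and an open neighbourhood of it. -/
theorem exists_contDiff_cutoff {K U : Set (Space N)} (hK : IsCompact K) (hU : IsOpen U)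
    (hKU : K ⊆ U) :
    ∃ g : Space N → ℝ, ContDiff ℝ 1 g ∧ HasCompactSupport g ∧ tsupport g ⊆ U ∧
      (∀ x, 0 ≤ g x) ∧ (∀ x, g x ≤ 1) ∧ ∀ x ∈ K, g x = 1 := by
  obtain ⟨L, hL, hKL, hLU⟩ := exists_compact_between hK hU hKU
  obtain ⟨f, hf1, hf0, hf⟩ := exists_contMDiffMap_one_nhds_of_subset_interior
    (modelWithCornersSelf ℝ (Space N)) (n := 1) hK.isClosed hKL
  have hsupp : Function.support f ⊆ L := fun x hx => by
    by_contra h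
    exact hx (hf0 x h)
  have htsupp : tsupport f ⊆ L := closure_minimal hsupp hL.isClosed
  exact ⟨f, f.contMDiff.contDiff, hL.of_isClosed_subset (isClosed_tsupport _) htsupp,
    htsupp.trans hLU, fun x => (hf x).1, fun x => (hf x).2,
    fun x hx => hf1.self_of_nhdsSet x hx⟩

/-- Up to small mass of `|w|`, measurable sets can be replaced by compact subsets. -/
theorem exists_isCompact_setIntegral_abs_sdiff_lt {w : Space N → ℝ} (hw : Integrable w)
    {A : Set (Space N)} (hA : MeasurableSet A) {ε : ℝ} (hε : 0 < ε) :
    ∃ K ⊆ A, IsCompact K ∧ ∫ x in A \ K, |w x| < ε := by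
  have hfin : ∫⁻ x, ‖w x‖ₑ ≠ ∞ := hw.2.ne
  -- Inner regularity is applied to the finite measure `|w| dx`, so `A` may have infinite volume.
  have : IsFiniteMeasure (volume.withDensity fun x => ‖w x‖ₑ) :=
    isFiniteMeasure_withDensity hfin
  obtain ⟨K, hKA, hK, hlt⟩ := hA.exists_isCompact_sdiff_lt
    (μ := volume.withDensity fun x => ‖w x‖ₑ) (measure_ne_top _ _)
    (ENNReal.ofReal_pos.mpr hε).ne'
  refine ⟨K, hKA, hK, ?_⟩
  rw [withDensity_apply _ (hA.diff hK.measurableSet)] at hlt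
  have h1 : ∫ x in A \ K, |w x| = (∫⁻ x in A \ K, ‖w x‖ₑ).toReal :=
    integral_norm_eq_lintegral_enorm hw.1.restrict
  rw [h1]
  exact (ENNReal.lt_ofReal_iff_toReal_lt hlt.ne_top).mp hlt

/-- Duality: the `L¹` norm on an open set is controlled by testing against smooth compactly
supported functions bounded by one. -/
theorem setIntegral_abs_le_of_forall_test {U : Set (Space N)} (hU : IsOpen U)
    {w : Space N → ℝ} (hw : Integrable w) {C : ℝ}
    (h : ∀ g : Space N → ℝ, ContDiff ℝ 1 g → HasCompactSupport g → tsupport g ⊆ U →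
      (∀ x, |g x| ≤ 1) → ∫ x, w x * g x ≤ C) :
    ∫ x in U, |w x| ≤ C := by
  wlog hwm : Measurable w generalizing w
  · have hae : w =ᵐ[volume] hw.1.mk w := hw.1.ae_eq_mk
    have := this (w := hw.1.mk w) (hw.congr hae)
      (fun g h1 h2 h3 h4 => by
        rw [← integral_congr_ae (hae.mono fun x hx => by simp only [hx] :
          (fun x => w x * g x) =ᵐ[volume] fun x => hw.1.mk w x * g x)]
        exact h g h1 h2 h3 h4) hw.1.stronglyMeasurable_mk.measurable
    rwa [integral_congr_ae (ae_restrict_of_ae (hae.mono fun x hx => by simp only [hx]) :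
          (fun x => |w x|) =ᵐ[volume.restrict U] fun x => |hw.1.mk w x|)]
  refine le_of_forall_pos_le_add fun ε hε => ?_
  have hP : MeasurableSet (U ∩ {x | 0 < w x}) :=
    hU.measurableSet.inter (measurableSet_lt measurable_const hwm)
  have hQ : MeasurableSet (U ∩ {x | w x < 0}) :=
    hU.measurableSet.inter (measurableSet_lt hwm measurable_const)
  -- The two leftover sets each enter with weight 2 below, whence `ε / 4`.
  obtain ⟨K, hKP, hK, hKε⟩ := exists_isCompact_setIntegral_abs_sdiff_lt hw hP
    (by positivity : 0 < ε / 4)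
  obtain ⟨L, hLQ, hL, hLε⟩ := exists_isCompact_setIntegral_abs_sdiff_lt hw hQ
    (by positivity : 0 < ε / 4)
  have hKL : ∀ x ∈ K, x ∉ L := fun x hx hx' =>
    lt_asymm (show 0 < w x from (hKP hx).2) (hLQ hx').2
  -- Each cutoff avoids the other compact set, so `g - k` equals the sign of `w` on `K ∪ L`;
  -- elsewhere it lies in `[-1, 1]`.
  obtain ⟨g, hg, hgc, hgs, hg0, hg1, hgK⟩ := exists_contDiff_cutoff hK
    (hU.sdiff hL.isClosed) (fun x hx => ⟨(hKP hx).1, hKL x hx⟩)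
  obtain ⟨k, hk, hkc, hks, hk0, hk1, hkL⟩ := exists_contDiff_cutoff hL
    (hU.sdiff hK.isClosed) (fun x hx => ⟨(hLQ hx).1, fun hx' => hKL x hx' hx⟩)
  have hgL : ∀ x ∈ L, g x = 0 := fun x hx =>
    image_eq_zero_of_notMem_tsupport fun hx' => (hgs hx').2 hx
  have hkK : ∀ x ∈ K, k x = 0 := fun x hx =>
    image_eq_zero_of_notMem_tsupport fun hx' => (hks hx').2 hx
  have habs : ∀ x, |(g - k) x| ≤ 1 := fun x => by
    rw [Pi.sub_apply, abs_le]
    constructor <;> linarith [hg0 x, hg1 x, hk0 x, hk1 x]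
  have hts : tsupport (g - k) ⊆ U := (tsupport_sub _ _).trans
    (Set.union_subset (hgs.trans Set.sdiff_subset) (hks.trans Set.sdiff_subset))
  have htest := h (g - k) (hg.sub hk) (hgc.sub hkc) hts habs
  have hcont : Continuous (g - k) := (hg.sub hk).continuous
  have hint : Integrable fun x => w x * (g - k) x :=
    hw.mul_bdd hcont.aestronglyMeasurable (Eventually.of_forall fun x => by
      simpa [Real.norm_eq_abs] using habs x)
  set S := (U ∩ {x | 0 < w x}) \ K with hS
  set T := (U ∩ {x | w x < 0}) \ L with hT
  have hSm : MeasurableSet S := hP.diff hK.measurableSet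
  have hTm : MeasurableSet T := hQ.diff hL.measurableSet
  have hiS : Integrable (S.indicator fun x => |w x|) := hw.abs.indicator hSm
  have hiT : Integrable (T.indicator fun x => |w x|) := hw.abs.indicator hTm
  have hiST : Integrable fun x =>
      2 * S.indicator (fun x => |w x|) x + 2 * T.indicator (fun x => |w x|) x :=
    (hiS.const_mul 2).add (hiT.const_mul 2)
  have hpt : ∀ x ∈ U, |w x| ≤ w x * (g - k) x +
      (2 * S.indicator (fun x => |w x|) x + 2 * T.indicator (fun x => |w x|) x) := by
    intro x hxU
    have hb : -|w x| ≤ w x * (g - k) x := by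
      have : |w x * (g - k) x| ≤ |w x| := by
        rw [abs_mul]; exact mul_le_of_le_one_right (abs_nonneg _) (habs x)
      exact (neg_le_neg this).trans (neg_abs_le _)
    have hS0 : 0 ≤ S.indicator (fun x => |w x|) x :=
      Set.indicator_nonneg (fun _ _ => abs_nonneg _) _
    have hT0 : 0 ≤ T.indicator (fun x => |w x|) x :=
      Set.indicator_nonneg (fun _ _ => abs_nonneg _) _
    rcases lt_trichotomy (w x) 0 with hx | hx | hx
    · by_cases hxL : x ∈ L
      · rw [Pi.sub_apply, hgL x hxL, hkL x hxL, abs_of_neg hx]; linarith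
      · rw [Set.indicator_of_mem (show x ∈ T from ⟨⟨hxU, hx⟩, hxL⟩)]; linarith
    · rw [hx]; simp only [abs_zero, zero_mul]; linarith
    · by_cases hxK : x ∈ K
      · rw [Pi.sub_apply, hgK x hxK, hkK x hxK, abs_of_pos hx]; linarith
      · rw [Set.indicator_of_mem (show x ∈ S from ⟨⟨hxU, hx⟩, hxK⟩)]; linarith
  calc ∫ x in U, |w x|
      ≤ ∫ x in U, (w x * (g - k) x +
        (2 * S.indicator (fun x => |w x|) x + 2 * T.indicator (fun x => |w x|) x)) :=
        setIntegral_mono_on hw.abs.integrableOn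
          (hint.add hiST).integrableOn hU.measurableSet hpt
    _ = (∫ x in U, w x * (g - k) x) + (2 * (∫ x in U, S.indicator (fun x => |w x|) x) +
          2 * ∫ x in U, T.indicator (fun x => |w x|) x) := by
        rw [integral_add hint.integrableOn hiST.integrableOn,
          integral_add (hiS.const_mul 2).integrableOn (hiT.const_mul 2).integrableOn,
          integral_const_mul, integral_const_mul]
    _ ≤ C + (2 * (ε / 4) + 2 * (ε / 4)) := by
        have e1 : ∫ x in U, w x * (g - k) x = ∫ x, w x * (g - k) x :=
          setIntegral_eq_integral_of_forall_compl_eq_zero fun x hx => by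
            rw [image_eq_zero_of_notMem_tsupport fun hx' => hx (hts hx'), mul_zero]
        have e2 : ∫ x in U, S.indicator (fun x => |w x|) x ≤ ε / 4 := by
          rw [setIntegral_indicator hSm]
          refine le_trans (setIntegral_mono_set hw.abs.integrableOn
            (Eventually.of_forall fun _ => abs_nonneg _)
            (LE.le.eventuallyLE Set.inter_subset_right)) hKε.le
        have e3 : ∫ x in U, T.indicator (fun x => |w x|) x ≤ ε / 4 := by
          rw [setIntegral_indicator hTm]
          refine le_trans (setIntegral_mono_set hw.abs.integrableOn
            (Eventually.of_forall fun _ => abs_nonneg _)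
            (LE.le.eventuallyLE Set.inter_subset_right)) hLε.le
        rw [e1]
        linarith
    _ = C + ε := by ring

/-! ### Distributional variation and translates -/

theorem divergence_smul_const {f : Space N → ℝ} {x : Space N} (hf : DifferentiableAt ℝ f x)
    (w : Space N) : divergence (fun y => f y • w) x = fderiv ℝ f x w := by
  have hw : w = ∑ i, w i • EuclideanSpace.single i (1 : ℝ) := by
    simpa using ((EuclideanSpace.basisFun (Fin N) ℝ).sum_repr w).symm
  have h : fderiv ℝ (fun y => f y • w) x = (fderiv ℝ f x).smulRight w :=
    (hf.hasFDerivAt.smul_const w).fderiv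
  conv_rhs => rw [hw, map_sum]
  refine Finset.sum_congr rfl fun i _ => ?_
  rw [h, map_smul, ContinuousLinearMap.smulRight_apply, PiLp.smul_apply, smul_eq_mul,
    smul_eq_mul, mul_comm]

theorem continuous_divergence {F : Space N → Space N} (hF : ContDiff ℝ 1 F) :
    Continuous (divergence F) := by
  refine continuous_finsetSum _ fun i _ => ?_
  have h := hF.continuous_fderiv one_ne_zero
  fun_prop

theorem divergence_eq_zero_of_notMem_tsupport {F : Space N → Space N} {x : Space N}
    (hx : x ∉ tsupport F) : divergence F x = 0 := by
  have h : fderiv ℝ F x = 0 := by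
    by_contra h
    exact hx (support_fderiv_subset ℝ h)
  simp [divergence, h]

/-- The integrable function `u` has total variation at most `M` in `Ω`, in the distributional
sense. -/
def HasVariationLE (Ω : Set (Space N)) (u : Space N → ℝ) (M : ℝ) : Prop :=
  ∀ ψ : Space N → Space N, ContDiff ℝ 1 ψ → HasCompactSupport ψ → tsupport ψ ⊆ Ω →
    (∀ x, ‖ψ x‖ ≤ 1) → ∫ x, u x * divergence ψ x ≤ M

/-- The shift is carried by the smooth factor, so `u` need only be integrable; the bounded
derivative of `g` gives the domination. -/
theorem hasDerivAt_integral_mul_comp_sub {u g : Space N → ℝ} (hu : Integrable u)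
    (hg : ContDiff ℝ 1 g) (hgc : HasCompactSupport g) (w : Space N) (s₀ : ℝ) :
    HasDerivAt (fun s : ℝ => ∫ y, u y * g (y - s • w))
      (∫ y, u y * (-(fderiv ℝ g (y - s₀ • w) w))) s₀ := by
  obtain ⟨B, hB⟩ := (hgc.fderiv ℝ).exists_bound_of_continuous
    (hg.continuous_fderiv one_ne_zero)
  obtain ⟨B', hB'⟩ := hgc.exists_bound_of_continuous hg.continuous
  have hcg : Continuous g := hg.continuous
  have hcd : Continuous (fderiv ℝ g) := hg.continuous_fderiv one_ne_zero
  refine (hasDerivAt_integral_of_dominated_loc_of_deriv_le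
    (F := fun s y => u y * g (y - s • w))
    (F' := fun s y => u y * (-(fderiv ℝ g (y - s • w) w)))
    (bound := fun y => |u y| * (B * ‖w‖)) (s := Set.univ) univ_mem ?_ ?_ ?_ ?_ ?_ ?_).2
  · exact Eventually.of_forall fun s => hu.1.mul
      (by fun_prop : Continuous fun y => g (y - s • w)).aestronglyMeasurable
  · exact hu.mul_bdd
      (by fun_prop : Continuous fun y => g (y - s₀ • w)).aestronglyMeasurable
      (Eventually.of_forall fun y => hB' _)
  · exact hu.1.mul
      (by fun_prop : Continuous fun y => -(fderiv ℝ g (y - s₀ • w) w)).aestronglyMeasurable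
  · refine Eventually.of_forall fun y s _ => ?_
    rw [norm_mul, norm_neg, Real.norm_eq_abs]
    gcongr
    exact (ContinuousLinearMap.le_opNorm _ _).trans (by gcongr; exact hB _)
  · exact hu.abs.mul_const _
  · refine Eventually.of_forall fun y s _ => ?_
    have h1 : HasDerivAt (fun s : ℝ => y - s • w) (-w) s := by
      simpa using ((hasDerivAt_id s).smul_const w).const_sub y
    have h2 := ((hg.differentiable one_ne_zero (y - s • w)).hasFDerivAt).comp_hasDerivAt s h1
    rw [map_neg] at h2
    exact h2.const_mul (u y)

/-- A function of bounded variation is close to its translates, on sets whose translates stay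
inside the domain. -/
theorem HasVariationLE.setIntegral_abs_translate_sub_le {Ω U : Set (Space N)}
    {u : Space N → ℝ} {M : ℝ} (hV : HasVariationLE Ω u M) (hu : Integrable u) (hU : IsOpen U)
    {w : Space N} (hw : ‖w‖ ≤ 2) {t : ℝ} (ht : 0 ≤ t)
    (hUw : ∀ x ∈ U, ∀ s ∈ Set.Icc 0 t, x + s • w ∈ Ω) :
    ∫ x in U, |u (x + t • w) - u x| ≤ 2 * M * t := by
  have hut : Integrable fun x => u (x + t • w) := hu.comp_add_right _
  refine setIntegral_abs_le_of_forall_test hU (hut.sub hu) fun g hg hgc hgs hg1 => ?_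
  obtain ⟨B, hB⟩ := hgc.exists_bound_of_continuous hg.continuous
  have hcg : Continuous g := hg.continuous
  -- Moving the translation back onto `u` gives `F s = ∫ u(x + s w) g(x)`, so `F t - F 0` is the
  -- tested difference and the mean value inequality applies.
  set F : ℝ → ℝ := fun s => ∫ y, u y * g (y - s • w) with hF
  have hFd := fun s => hasDerivAt_integral_mul_comp_sub hu hg hgc w s
  have hF' : ∀ s ∈ Set.Icc 0 t, deriv F s ≤ 2 * M := by
    intro s hs
    -- The factor `1/2` offsets `‖w‖ ≤ 2`, keeping `‖ψ‖ ≤ 1`; it is the source of the 2 in `2 * M`.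
    -- The support of `ψ` is a translate of that of `g` by `s • w`, hence inside `Ω`.
    set ψ : Space N → Space N := fun y => (-(1 / 2) * g (y - s • w)) • w with hψ
    have hdg : ContDiff ℝ 1 fun y => -(1 / 2) * g (y - s • w) :=
      contDiff_const.mul (hg.comp (contDiff_id.sub contDiff_const))
    have hsup : tsupport ψ ⊆ (fun y => y - s • w) ⁻¹' tsupport g :=
      closure_minimal (fun y hy => by
        refine subset_tsupport g fun h0 => hy ?_
        simp [hψ, h0]) ((isClosed_tsupport g).preimage (by fun_prop))
    have hcomp : IsCompact ((fun y => y - s • w) ⁻¹' tsupport g) :=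
      (Homeomorph.subRight (s • w)).isCompact_preimage.mpr hgc
    have hle := hV ψ (hdg.smul contDiff_const)
      (hcomp.of_isClosed_subset (isClosed_tsupport _) hsup)
      (fun y hy => by
        have := hUw _ (hgs (hsup hy)) s hs
        simpa using this)
      (fun y => by
        rw [hψ, norm_smul, norm_mul, Real.norm_eq_abs, Real.norm_eq_abs, abs_neg,
          abs_of_pos (by norm_num : (0 : ℝ) < 1 / 2)]
        nlinarith [hg1 (y - s • w), abs_nonneg (g (y - s • w)), norm_nonneg w])
    have hdiv : ∀ y, divergence ψ y = (1 / 2) * (-(fderiv ℝ g (y - s • w) w)) := by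
      intro y
      rw [hψ, divergence_smul_const (hdg.differentiable one_ne_zero y)]
      have h1 : HasFDerivAt (fun y => -(1 / 2) * g (y - s • w))
          ((-(1 / 2) : ℝ) • (fderiv ℝ g (y - s • w))) y := by
        have := (hg.differentiable one_ne_zero (y - s • w)).hasFDerivAt.comp y
          ((hasFDerivAt_id y).sub_const (s • w))
        exact this.const_mul _
      rw [h1.fderiv]
      simp
    rw [(hFd s).deriv]
    have : ∫ y, u y * divergence ψ y =
        (1 / 2) * ∫ y, u y * (-(fderiv ℝ g (y - s • w) w)) := by
      rw [← integral_const_mul]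
      refine integral_congr_ae (Eventually.of_forall fun y => ?_)
      simp only [hdiv]; ring
    linarith
  have hmv := (convex_Icc 0 t).image_sub_le_mul_sub_of_deriv_le
    (fun s _ => (hFd s).continuousAt.continuousWithinAt)
    (fun s _ => (hFd s).differentiableAt.differentiableWithinAt)
    (fun s hs => hF' s (interior_subset hs)) 0 ⟨le_rfl, ht⟩ t ⟨ht, le_rfl⟩ ht
  have e1 : F t = ∫ x, u (x + t • w) * g x := by
    rw [hF]
    exact (integral_add_right_eq_self (fun y => u y * g (y - t • w)) (t • w)).symm.trans
      (by simp)
  have e0 : F 0 = ∫ x, u x * g x := by simp [hF]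
  have i1 : Integrable fun x => u (x + t • w) * g x :=
    hut.mul_bdd hcg.aestronglyMeasurable (Eventually.of_forall hB)
  have i0 : Integrable fun x => u x * g x :=
    hu.mul_bdd hcg.aestronglyMeasurable (Eventually.of_forall hB)
  calc ∫ x, (u (x + t • w) - u x) * g x = F t - F 0 := by
        rw [e1, e0, ← integral_sub i1 i0]
        simp only [sub_mul]
    _ ≤ 2 * M * (t - 0) := hmv
    _ = 2 * M * t := by ring

/-! ### Interior cones of Lipschitz domains -/

/-- The uniform interior cone condition near `x₀`. -/
def HasInteriorConesNear (Ω : Set (Space N)) (x₀ : Space N) : Prop :=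
  ∃ v : Space N, ‖v‖ ≤ 1 ∧ ∃ κ : ℝ, 0 < κ ∧ κ ≤ 1 ∧ ∃ ρ : ℝ, 0 < ρ ∧ ∃ τ : ℝ, 0 < τ ∧
    ∀ x ∈ Ω ∩ Metric.ball x₀ ρ, ∀ w ∈ Metric.ball v κ, ∀ s ∈ Set.Icc 0 τ, x + s • w ∈ Ω

/-- Moving by `s • w` raises the height by at least `s (1 - ‖w - v‖)`, while the graph rises by at
most `K s ‖w - v‖`. The point stays above the graph when `‖w - v‖ (1 + K) ≤ 1`. -/
theorem HasLipschitzBoundary.hasInteriorConesNear {Ω : Set (Space N)} (hΩ : IsOpen Ω)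
    (hlip : HasLipschitzBoundary Ω) {x₀ : Space N} (hx₀ : x₀ ∈ closure Ω) :
    HasInteriorConesNear Ω x₀ := by
  by_cases hx : x₀ ∈ Ω
  · obtain ⟨r, hr, hball⟩ := Metric.isOpen_iff.mp hΩ x₀ hx
    -- At an interior point every direction is allowed, so the axis can be `0`.
    refine ⟨0, by simp, 1, one_pos, le_rfl, r / 2, by positivity, r / 2, by positivity, ?_⟩
    intro x hx w hw s hs
    apply hball
    rw [Metric.mem_ball, dist_eq_norm]
    have h1 : ‖x - x₀‖ < r / 2 := by simpa [dist_eq_norm] using hx.2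
    have h2 : ‖w‖ < 1 := by simpa using hw
    have h3 : ‖s • w‖ ≤ r / 2 := by
      rw [norm_smul, Real.norm_eq_abs, abs_of_nonneg hs.1]
      nlinarith [hs.2, hs.1, norm_nonneg w]
    calc ‖x + s • w - x₀‖ = ‖(x - x₀) + s • w‖ := by congr 1; abel
      _ ≤ ‖x - x₀‖ + ‖s • w‖ := norm_add_le _ _
      _ < r := by linarith
  · obtain ⟨v, hv, r, hr, K, γ, hγ, hiff⟩ := hlip x₀ (by
      rw [hΩ.frontier_eq]; exact ⟨hx₀, hx⟩)
    have hK : (0 : ℝ) < 1 + K := by positivity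
    -- Since `‖w‖ ≤ 2`, times up to `r / 8` move a point by at most `r / 4`, so it stays in the ball
    -- where the graph description is valid.
    refine ⟨v, hv.le, 1 / (1 + K), by positivity, ?_, r / 2, by positivity, r / 8,
      by positivity, ?_⟩
    · rw [div_le_one hK]; linarith [K.coe_nonneg]
    intro x hx w hw s hs
    have hκ1 : (1 : ℝ) / (1 + K) ≤ 1 := by rw [div_le_one hK]; linarith [K.coe_nonneg]
    have h1 : ‖x - x₀‖ < r / 2 := by simpa [dist_eq_norm] using hx.2
    have hwv : ‖w - v‖ < 1 / (1 + K) := by rw [← dist_eq_norm]; exact hw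
    have h2 : ‖w‖ ≤ 2 := by
      calc ‖w‖ = ‖(w - v) + v‖ := by simp
        _ ≤ ‖w - v‖ + ‖v‖ := norm_add_le _ _
        _ ≤ 2 := by linarith
    have h3 : ‖s • w‖ ≤ r / 4 := by
      rw [norm_smul, Real.norm_eq_abs, abs_of_nonneg hs.1]
      nlinarith [hs.2, hs.1, norm_nonneg w]
    have hmem : x + s • w ∈ Metric.ball x₀ r := by
      rw [Metric.mem_ball, dist_eq_norm]
      calc ‖x + s • w - x₀‖ = ‖(x - x₀) + s • w‖ := by congr 1; abel
        _ ≤ ‖x - x₀‖ + ‖s • w‖ := norm_add_le _ _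
        _ < r := by linarith
    rw [hiff _ hmem]
    have hxγ := (hiff x (Metric.ball_subset_ball (by linarith) hx.2)).mp hx.1
    set P := (Submodule.span ℝ {v})ᗮ.orthogonalProjectionOnto with hP
    have hPv : P v = 0 := by
      exact Submodule.orthogonalProjectionOnto_orthogonalComplement_singleton_eq_zero v
    have hPw : ‖P w‖ ≤ ‖w - v‖ := by
      have : P w = P (w - v) := by rw [map_sub, hPv, sub_zero]
      rw [this]
      exact Submodule.norm_orthogonalProjectionOnto_apply_le _ _
    have hγle : γ (P (x + s • w)) ≤ γ (P x) + K * (s * ‖w - v‖) := by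
      have := hγ.dist_le_mul (P (x + s • w)) (P x)
      rw [dist_eq_norm, dist_eq_norm, ← map_sub, add_sub_cancel_left, map_smul, norm_smul,
        Real.norm_eq_abs, Real.norm_eq_abs, abs_of_nonneg hs.1] at this
      have h5 : K * (s * ‖P w‖) ≤ K * (s * ‖w - v‖) := by
        have := hs.1
        gcongr
      linarith [le_abs_self (γ (P (x + s • w)) - γ (P x))]
    have hin : inner ℝ v x + s * (1 - ‖w - v‖) ≤ inner ℝ v (x + s • w) := by
      have e : inner ℝ v w = 1 + inner ℝ v (w - v) := by
        rw [inner_sub_right, real_inner_self_eq_norm_sq, hv]; ring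
      have : -‖w - v‖ ≤ inner ℝ v (w - v) := by
        have := abs_le.mp (abs_real_inner_le_norm v (w - v))
        rw [hv, one_mul] at this
        exact this.1
      rw [inner_add_right, inner_smul_right, e]
      nlinarith [hs.1]
    have hfin : K * (s * ‖w - v‖) ≤ s * (1 - ‖w - v‖) := by
      have : ‖w - v‖ * (1 + K) ≤ 1 := by
        rw [← le_div_iff₀ hK]; exact hwv.le
      nlinarith [hs.1]
    linarith

/-! ### Control of the `L¹` norm by finitely many averages -/

theorem HasVariationLE.nonneg {Ω : Set (Space N)} {u : Space N → ℝ} {M : ℝ}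
    (hV : HasVariationLE Ω u M) : 0 ≤ M := by
  have := hV (fun _ => 0) contDiff_const HasCompactSupport.zero (by simp [tsupport])
    (by simp)
  simpa [divergence] using this

/-- The mean oscillation of a function of bounded variation over balls entering the interior
cones is small. -/
theorem HasVariationLE.setIntegral_integral_oscillation_le {Ω U : Set (Space N)}
    {u : Space N → ℝ} {M : ℝ} (hV : HasVariationLE Ω u M) (hu : Integrable u) (hU : IsOpen U)
    {v : Space N} (hv : ‖v‖ ≤ 1) {κ t : ℝ} (hκ : κ ≤ 1) (ht : 0 < t)
    (hcone : ∀ x ∈ U, ∀ w ∈ Metric.ball v κ, ∀ s ∈ Set.Icc 0 t, x + s • w ∈ Ω) :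
    IntegrableOn (fun x => ∫ y in Metric.ball (x + t • v) (κ * t), |u x - u y|) U ∧
    ∫ x in U, (∫ y in Metric.ball (x + t • v) (κ * t), |u x - u y|) ≤
      2 * M * t * volume.real (Metric.ball (0 : Space N) (κ * t)) := by
  set B : Set (Space N) := Metric.ball (-(t • v)) (κ * t) with hB
  have hBm : MeasurableSet B := Metric.isOpen_ball.measurableSet
  set χ : Space N → ℝ := B.indicator fun _ => 1 with hχ
  have hχi : Integrable χ := (integrable_indicator_iff hBm).mpr (integrableOn_const
    measure_ball_lt_top.ne)
  -- After substituting `y = x - h`, the domain of `h` no longer depends on `x`. Fubini then leaves,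
  -- for each `h`, a translation estimate in direction `-h / t`.
  set H : Space N × Space N → ℝ := fun p => |u p.1 * χ p.2 - χ p.2 * u (p.1 - p.2)| with hH
  have hHi : Integrable H (volume.prod volume) :=
    ((hu.mul_prod hχi).sub
      (hχi.convolution_integrand (ContinuousLinearMap.mul ℝ ℝ) hu)).abs
  have hHU : Integrable H ((volume.restrict U).prod volume) := by
    have := hHi.mono_measure (Measure.restrict_le_self (s := U ×ˢ Set.univ))
    rwa [← Measure.prod_restrict, Measure.restrict_univ] at this
  have hslice : ∀ x, ∫ y in Metric.ball (x + t • v) (κ * t), |u x - u y| = ∫ h, H (x, h) := by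
    intro x
    rw [← integral_indicator Metric.isOpen_ball.measurableSet,
      ← integral_sub_left_eq_self _ volume x]
    refine integral_congr_ae (Eventually.of_forall fun h => ?_)
    have hiff : x - h ∈ Metric.ball (x + t • v) (κ * t) ↔ h ∈ B := by
      rw [hB, Metric.mem_ball, Metric.mem_ball, dist_eq_norm, dist_eq_norm,
        ← norm_neg (h - -(t • v))]
      congr! 2
      abel
    by_cases hh : h ∈ B
    · simp only [hH, hχ]
      rw [Set.indicator_of_mem (hiff.mpr hh), Set.indicator_of_mem hh, mul_one, one_mul]
    · simp only [hH, hχ]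
      rw [Set.indicator_of_notMem (fun h' => hh (hiff.mp h')), Set.indicator_of_notMem hh]
      simp
  simp only [hslice]
  refine ⟨hHU.integral_prod_left, ?_⟩
  have hinner : ∀ h, ∫ x in U, H (x, h) ≤ 2 * M * t * χ h := by
    intro h
    by_cases hh : h ∈ B
    · have hhw : -(t⁻¹ • h) ∈ Metric.ball v κ := by
        rw [hB, Metric.mem_ball, dist_eq_norm] at hh
        rw [Metric.mem_ball, dist_eq_norm]
        have e : -(t⁻¹ • h) - v = -(t⁻¹ • (h - -(t • v))) := by
          rw [sub_neg_eq_add, smul_add, smul_smul, inv_mul_cancel₀ ht.ne', one_smul]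
          abel
        rw [e, norm_neg, norm_smul, norm_inv, Real.norm_eq_abs, abs_of_pos ht,
          inv_mul_lt_iff₀ ht, mul_comm]
        exact hh
      have hnorm : ‖-(t⁻¹ • h)‖ ≤ 2 := by
        rw [Metric.mem_ball, dist_eq_norm] at hhw
        calc ‖-(t⁻¹ • h)‖ = ‖(-(t⁻¹ • h) - v) + v‖ := by rw [sub_add_cancel]
          _ ≤ ‖-(t⁻¹ • h) - v‖ + ‖v‖ := norm_add_le _ _
          _ ≤ 2 := by linarith
      have hkey := hV.setIntegral_abs_translate_sub_le hu hU hnorm ht.le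
        (fun x hx s hs => hcone x hx _ hhw s hs)
      simp only [hH, hχ, Set.indicator_of_mem hh, mul_one, one_mul]
      refine le_trans (le_of_eq ?_) hkey
      refine integral_congr_ae (Eventually.of_forall fun x => ?_)
      simp only [smul_neg, smul_smul, mul_inv_cancel₀ ht.ne', one_smul, ← sub_eq_add_neg]
      exact abs_sub_comm _ _
    · simp only [hH, hχ, Set.indicator_of_notMem hh]
      simp
  calc ∫ x in U, ∫ h, H (x, h) = ∫ h, ∫ x in U, H (x, h) :=
        integral_integral_swap (f := fun x h => H (x, h)) hHU
    _ ≤ ∫ h, 2 * M * t * χ h :=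
        integral_mono hHU.integral_prod_right (hχi.const_mul _) hinner
    _ = 2 * M * t * volume.real (Metric.ball (0 : Space N) (κ * t)) := by
        rw [integral_const_mul, hχ, integral_indicator hBm, setIntegral_const, smul_eq_mul,
          mul_one, hB, Measure.addHaar_real_ball_center]

/-- Near a point with the interior cone property, the `L¹` norm of functions of bounded variation
is controlled, up to a small error, by finitely many averages. -/
theorem HasInteriorConesNear.exists_setIntegral_abs_le {Ω : Set (Space N)} (hΩ : IsOpen Ω)
    {x₀ : Space N} (hx₀ : HasInteriorConesNear Ω x₀) :
    ∃ ρ : ℝ, 0 < ρ ∧ ∀ M ε : ℝ, 0 < ε → ∃ (D : Finset (Set (Space N))) (c : ℝ), 0 ≤ c ∧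
      ∀ u : Space N → ℝ, Integrable u → HasVariationLE Ω u M →
        ∫ x in Ω ∩ Metric.ball x₀ ρ, |u x| ≤ ε + c * ∑ d ∈ D, |∫ x in d, u x| := by
  classical
  obtain ⟨v, hv, κ, hκ, hκ1, ρ, hρ, τ, hτ, hcone⟩ := hx₀
  refine ⟨ρ, hρ, fun M ε hε => ?_⟩
  set n := Module.finrank ℝ (Space N)
  -- Chosen so that the oscillation bound `2 M t |B(κt)| = 2 M t 2^n m` is at most `ε m`; the `+ 1`
  -- keeps the denominator positive.
  set t := min τ (ε / (2 ^ (n + 1) * (|M| + 1))) with ht_def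
  have hden : 0 < 2 ^ (n + 1) * (|M| + 1) := by positivity
  have ht : 0 < t := lt_min hτ (by positivity)
  have htM : 2 ^ (n + 1) * |M| * t ≤ ε := by
    have h1 : t * (2 ^ (n + 1) * (|M| + 1)) ≤ ε :=
      (le_div_iff₀ hden).mp (min_le_right _ _)
    have h2 : 0 ≤ t * 2 ^ (n + 1) := by positivity
    nlinarith
  set U := Ω ∩ Metric.ball x₀ ρ with hU_def
  have hU : IsOpen U := hΩ.inter Metric.isOpen_ball
  have hUfin : volume U ≠ ∞ :=
    ((measure_mono Set.inter_subset_right).trans_lt measure_ball_lt_top).ne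
  -- With half the radius, the shifted ball about a net point within `r` of `x` lies in the ball of
  -- radius `κ * t` about `x + t • v`.
  set r := κ * t / 2 with hr_def
  have hr : 0 < r := by positivity
  set m := volume.real (Metric.ball (0 : Space N) r) with hm_def
  have hm : 0 < m := ENNReal.toReal_pos (Metric.measure_ball_pos _ _ hr).ne'
    measure_ball_lt_top.ne
  have hm2 : volume.real (Metric.ball (0 : Space N) (κ * t)) = 2 ^ n * m := by
    have h := Measure.addHaar_ball_mul_of_pos (volume : Measure (Space N)) 0
      (by norm_num : (0 : ℝ) < 2) r
    rw [show 2 * r = κ * t by rw [hr_def]; ring] at h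
    rw [measureReal_def, h, ENNReal.toReal_mul, ENNReal.toReal_ofReal (by positivity)]
    rfl
  obtain ⟨J, -, hJ, hcover⟩ := (isCompact_closedBall x₀ ρ).finite_cover_balls hr
  refine ⟨hJ.toFinset.image fun z => Metric.ball (z + t • v) r, volume.real U / m,
    by positivity, fun u hu hV => ?_⟩
  set S := ∑ d ∈ hJ.toFinset.image fun z => Metric.ball (z + t • v) r, |∫ x in d, u x|
  obtain ⟨hosc_int, hosc⟩ := hV.setIntegral_integral_oscillation_le hu hU hv hκ1 ht
    (fun x hx w hw s hs => hcone x hx w hw s ⟨hs.1, hs.2.trans (min_le_left _ _)⟩)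
  -- Integrate `u x = u y + (u x - u y)` over the net ball `d`, which has measure `m`.
  have hpt : ∀ x ∈ U, m * |u x| ≤
      S + ∫ y in Metric.ball (x + t • v) (κ * t), |u x - u y| := by
    intro x hx
    obtain ⟨z, hz, hxz⟩ := Set.mem_iUnion₂.mp (hcover (Metric.ball_subset_closedBall hx.2))
    set d := Metric.ball (z + t • v) r with hd
    have hdfin : volume d ≠ ∞ := measure_ball_lt_top.ne
    have hconst : IntegrableOn (fun _ => u x) d := integrableOn_const hdfin
    have hsub : d ⊆ Metric.ball (x + t • v) (κ * t) := by
      refine Metric.ball_subset_ball' ?_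
      rw [dist_add_right, dist_comm]
      have := (Metric.mem_ball.mp hxz).le
      linarith
    have h1 : m * u x = (∫ y in d, u y) + ∫ y in d, (u x - u y) := by
      rw [integral_sub hconst hu.integrableOn, setIntegral_const, hd,
        Measure.addHaar_real_ball_center, smul_eq_mul]
      ring
    have h2 : |∫ y in d, u y| ≤ S :=
      Finset.single_le_sum (f := fun d => |∫ y in d, u y|) (fun _ _ => abs_nonneg _)
        (Finset.mem_image_of_mem _ (hJ.mem_toFinset.mpr hz))
    have h3 : |∫ y in d, (u x - u y)| ≤
        ∫ y in Metric.ball (x + t • v) (κ * t), |u x - u y| := by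
      refine abs_integral_le_integral_abs.trans (setIntegral_mono_set ?_
        (Eventually.of_forall fun _ => abs_nonneg _) hsub.eventuallyLE)
      exact ((integrableOn_const measure_ball_lt_top.ne).sub hu.integrableOn).abs
    calc m * |u x| = |m * u x| := by rw [abs_mul, abs_of_pos hm]
      _ ≤ |∫ y in d, u y| + |∫ y in d, (u x - u y)| := by rw [h1]; exact abs_add_le _ _
      _ ≤ _ := add_le_add h2 h3
  have hSi : Integrable (fun _ => S) (volume.restrict U) := integrableOn_const hUfin
  have hint := setIntegral_mono_on (hu.abs.integrableOn.const_mul m)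
    (hSi.add hosc_int) hU.measurableSet hpt
  rw [integral_const_mul, integral_add' hSi hosc_int, setIntegral_const, smul_eq_mul] at hint
  rw [hm2] at hosc
  have hMle : 2 * M * t * (2 ^ n * m) ≤ ε * m := by
    rw [abs_of_nonneg hV.nonneg, pow_succ] at htM
    nlinarith
  have : m * ∫ x in U, |u x| ≤ m * (ε + volume.real U / m * S) := by
    have e : m * (ε + volume.real U / m * S) = ε * m + volume.real U * S := by
      field_simp
    rw [e]
    linarith
  exact le_of_mul_le_mul_left this hm

/-- On a bounded Lipschitz domain, the `L¹` norm of functions of bounded variation is controlled,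
up to a small error, by finitely many averages. -/
theorem HasLipschitzBoundary.exists_setIntegral_abs_le {Ω : Set (Space N)} (hΩ : IsOpen Ω)
    (hlip : HasLipschitzBoundary Ω) (hbdd : Bornology.IsBounded Ω) (M : ℝ) {ε : ℝ}
    (hε : 0 < ε) :
    ∃ (D : Finset (Set (Space N))) (c : ℝ), 0 ≤ c ∧
      ∀ u : Space N → ℝ, Integrable u → HasVariationLE Ω u M →
        ∫ x in Ω, |u x| ≤ ε + c * ∑ d ∈ D, |∫ x in d, u x| := by
  classical
  -- The radii depend on neither `M` nor the error, so the finite cover is fixed before `ε` is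
  -- divided among its members.
  choose! ρ hρ hloc using fun (x : Space N) (hx : x ∈ closure Ω) =>
    (hlip.hasInteriorConesNear hΩ hx).exists_setIntegral_abs_le hΩ
  obtain ⟨J, hJ, hcover⟩ := hbdd.isCompact_closure.elim_nhds_subcover
    (fun x => Metric.ball x (ρ x)) (fun x hx => Metric.ball_mem_nhds x (hρ x hx))
  have hε' : 0 < ε / (J.card + 1) := by positivity
  choose! D c hc hest using fun (x : Space N) (hx : x ∈ closure Ω) => hloc x hx M _ hε'
  refine ⟨J.biUnion D, ∑ z ∈ J, c z, Finset.sum_nonneg fun z hz => hc z (hJ z hz),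
    fun u hu hV => ?_⟩
  have hsub : Ω ⊆ ⋃ z ∈ J, Ω ∩ Metric.ball z (ρ z) := fun x hx => by
    obtain ⟨z, hz, hxz⟩ := Set.mem_iUnion₂.mp (hcover (subset_closure hx))
    exact Set.mem_iUnion₂.mpr ⟨z, hz, hx, hxz⟩
  have hmeas : ∀ z, MeasurableSet (Ω ∩ Metric.ball z (ρ z)) := fun z =>
    (hΩ.inter Metric.isOpen_ball).measurableSet
  have hsum : ∫ x in Ω, |u x| ≤ ∑ z ∈ J, ∫ x in Ω ∩ Metric.ball z (ρ z), |u x| := by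
    simp only [← integral_indicator (hmeas _), ← integral_indicator hΩ.measurableSet]
    rw [← integral_finsetSum _ fun z _ => hu.abs.indicator (hmeas z)]
    refine integral_mono (hu.abs.indicator hΩ.measurableSet)
      (integrable_finsetSum _ fun z _ => hu.abs.indicator (hmeas z)) fun x => ?_
    have hnn : ∀ z ∈ J, 0 ≤ (Ω ∩ Metric.ball z (ρ z)).indicator (fun x => |u x|) x :=
      fun z _ => Set.indicator_nonneg (fun _ _ => abs_nonneg _) _
    by_cases hx : x ∈ Ω
    · obtain ⟨z, hz, hxz⟩ := Set.mem_iUnion₂.mp (hsub hx)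
      rw [Set.indicator_of_mem hx]
      refine le_trans (le_of_eq ?_) (Finset.single_le_sum hnn hz)
      rw [Set.indicator_of_mem hxz]
    · rw [Set.indicator_of_notMem hx]
      exact Finset.sum_nonneg hnn
  calc ∫ x in Ω, |u x| ≤ ∑ z ∈ J, ∫ x in Ω ∩ Metric.ball z (ρ z), |u x| := hsum
    _ ≤ ∑ z ∈ J, (ε / (J.card + 1) + c z * ∑ d ∈ J.biUnion D, |∫ x in d, u x|) := by
        refine Finset.sum_le_sum fun z hz => (hest z (hJ z hz) u hu hV).trans ?_
        gcongr
        · exact hc z (hJ z hz)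
        · exact fun d hd => Finset.mem_biUnion.mpr ⟨z, hz, hd⟩
    _ = J.card * (ε / (J.card + 1)) + (∑ z ∈ J, c z) *
          ∑ d ∈ J.biUnion D, |∫ x in d, u x| := by
        rw [Finset.sum_add_distrib, Finset.sum_const, nsmul_eq_mul, Finset.sum_mul]
    _ ≤ _ := by
        gcongr
        rw [mul_div_assoc', div_le_iff₀ (by positivity)]
        nlinarith

/-! ### Differences and extension by zero -/

theorem HasVariationLE.sub {Ω : Set (Space N)} {u v : Space N → ℝ} {M M' : ℝ}
    (hu : HasVariationLE Ω u M) (hv : HasVariationLE Ω v M') (hui : Integrable u)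
    (hvi : Integrable v) : HasVariationLE Ω (u - v) (M + M') := by
  intro ψ hψ hψc hψs hψ1
  have hcont := continuous_divergence hψ
  have hc : HasCompactSupport (divergence ψ) :=
    HasCompactSupport.intro hψc fun x hx => divergence_eq_zero_of_notMem_tsupport hx
  obtain ⟨B, hB⟩ := hc.exists_bound_of_continuous hcont
  have h1 := hu ψ hψ hψc hψs hψ1
  have h2 := hv (-ψ) hψ.neg hψc.neg (by rwa [tsupport_neg]) (by simpa using hψ1)
  have hneg : ∀ x, divergence (-ψ) x = -divergence ψ x := fun x => by
    simp [divergence, fderiv_neg]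
  simp only [hneg, mul_neg, integral_neg] at h2
  have e : ∫ x, (u - v) x * divergence ψ x =
      (∫ x, u x * divergence ψ x) - ∫ x, v x * divergence ψ x := by
    rw [← integral_sub (hui.mul_bdd hcont.aestronglyMeasurable (Eventually.of_forall hB))
      (hvi.mul_bdd hcont.aestronglyMeasurable (Eventually.of_forall hB))]
    simp only [Pi.sub_apply, sub_mul]
  linarith

theorem integrable_indicator_L1 {Ω : Set (Space N)} (hΩ : IsOpen Ω) (f : L1 Ω) :
    Integrable (Ω.indicator f) :=
  (integrable_indicator_iff hΩ.measurableSet).mpr (L1.integrable_coeFn f)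

/-! ### From nonlocal to local variation -/

/-- The bound `c ≤ ω` makes the quotient both `C¹` and at most one in norm. Values of `ω` off `Ω ×ˢ
Ω` do not matter, since the field vanishes near every such point. -/
theorem isTestField_separated {Ω : Set (Space N)} (hΩ : IsOpen Ω)
    {ω : Space N × Space N → ℝ} (hω : IsAdmissibleWeight Ω ω) {c : ℝ} (hc : 0 < c)
    (hcω : ∀ x ∈ Ω, ∀ y ∈ Ω, c ≤ ω (x, y)) {η : Space N → ℝ} (hη : ContDiff ℝ 1 η)
    (hηc : HasCompactSupport η) (hηs : tsupport η ⊆ Ω) (hη1 : ∀ x, |η x| ≤ 1)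
    {ψ : Space N → Space N} (hψ : ContDiff ℝ 1 ψ) (hψc : HasCompactSupport ψ)
    (hψs : tsupport ψ ⊆ Ω) (hψ1 : ∀ x, ‖ψ x‖ ≤ 1) :
    IsTestField Ω fun p => (-(c * η p.2) / ω p) • ψ p.1 := by
  have hts : tsupport (fun p : Space N × Space N => (-(c * η p.2) / ω p) • ψ p.1) ⊆
      tsupport ψ ×ˢ tsupport η := by
    refine closure_minimal (fun p hp => ⟨subset_tsupport ψ fun h => hp ?_,
      subset_tsupport η fun h => hp ?_⟩) ((isClosed_tsupport ψ).prod (isClosed_tsupport η))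
    · simp [h]
    · simp [h]
  have hsub := hts.trans (Set.prod_mono hψs hηs)
  refine ⟨contDiff_iff_contDiffAt.mpr fun p => ?_,
    (hψc.isCompact.prod hηc.isCompact).of_isClosed_subset (isClosed_tsupport _) hts,
    hsub, fun p => ?_⟩
  · by_cases hp : p ∈ Ω ×ˢ Ω
    · have h1 : ContDiffAt ℝ 1 ω p := hω.contDiffOn.contDiffAt ((hΩ.prod hΩ).mem_nhds hp)
      have h0 : ω p ≠ 0 := (hc.trans_le (hcω p.1 hp.1 p.2 hp.2)).ne'
      have h2 : ContDiffAt ℝ 1 (fun p : Space N × Space N => -(c * η p.2)) p :=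
        (contDiff_const.mul (hη.comp contDiff_snd)).neg.contDiffAt
      exact (h2.div h1 h0).smul (hψ.comp contDiff_fst).contDiffAt
    · have := notMem_tsupport_iff_eventuallyEq.mp fun h => hp (hsub h)
      exact (contDiffAt_const (c := (0 : Space N))).congr_of_eventuallyEq this
  · by_cases hp : p ∈ Ω ×ˢ Ω
    · have hcp := hcω p.1 hp.1 p.2 hp.2
      have h0 : 0 < ω p := hc.trans_le hcp
      rw [norm_smul, norm_div, norm_neg, norm_mul, Real.norm_eq_abs, Real.norm_eq_abs,
        Real.norm_eq_abs, abs_of_pos hc, abs_of_pos h0]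
      have : c * |η p.2| / ω p ≤ 1 := by
        rw [div_le_one h0]
        exact (mul_le_of_le_one_right hc.le (hη1 _)).trans hcp
      exact mul_le_one₀ this (norm_nonneg _) (hψ1 _)
    · have := image_eq_zero_of_notMem_tsupport fun h => hp (hsub h)
      simp only [this, norm_zero, zero_le_one]

/-- Symmetry of `ω` cancels the weight: the field under the divergence is `c η(y) ψ(x) - c η(x)
ψ(y)`, whose dependence on `x` and `y` separates. -/
theorem nonlocalDiv_separated {Ω : Set (Space N)} (hΩ : IsOpen Ω)
    {ω : Space N × Space N → ℝ} (hω : IsAdmissibleWeight Ω ω) {c : ℝ} (hc : 0 < c)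
    (hcω : ∀ x ∈ Ω, ∀ y ∈ Ω, c ≤ ω (x, y)) {η : Space N → ℝ} (hη : ContDiff ℝ 1 η)
    (hηc : HasCompactSupport η) (hηs : tsupport η ⊆ Ω)
    {ψ : Space N → Space N} (hψ : ContDiff ℝ 1 ψ) (hψc : HasCompactSupport ψ)
    (hψs : tsupport ψ ⊆ Ω) (x : Space N) :
    nonlocalDiv Ω ω (fun p => (-(c * η p.2) / ω p) • ψ p.1) x =
      c * ((∫ y, η y) * divergence ψ x) - c * fderiv ℝ η x (∫ y in Ω, ψ y) := by
  have hηi : Integrable η := hη.continuous.integrable_of_hasCompactSupport hηc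
  have hψi : Integrable ψ := hψ.continuous.integrable_of_hasCompactSupport hψc
  have hη0 : ∀ z, z ∉ Ω → η z = 0 := fun z hz =>
    image_eq_zero_of_notMem_tsupport fun h => hz (hηs h)
  have hψ0 : ∀ z, z ∉ Ω → ψ z = 0 := fun z hz =>
    image_eq_zero_of_notMem_tsupport fun h => hz (hψs h)
  have hslice : ∀ y ∈ Ω, divergence (fun z => ω (z, y) •
      ((-(c * η z) / ω (y, z)) • ψ y - (-(c * η y) / ω (z, y)) • ψ z)) x =
      c * (η y * divergence ψ x) - c * fderiv ℝ η x (ψ y) := by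
    intro y hy
    have hfun : (fun z => ω (z, y) •
        ((-(c * η z) / ω (y, z)) • ψ y - (-(c * η y) / ω (z, y)) • ψ z)) =
        fun z => (c * η y) • ψ z - (c * η z) • ψ y := by
      funext z
      by_cases hz : z ∈ Ω
      · have h0 : ω (z, y) ≠ 0 := (hc.trans_le (hcω z hz y hy)).ne'
        rw [← hω.symm z hz y hy, smul_sub, smul_smul, smul_smul, mul_div_cancel₀ _ h0,
          mul_div_cancel₀ _ h0, neg_smul, neg_smul]
        abel
      · simp [hη0 z hz, hψ0 z hz]
    rw [hfun]
    have hd1 : DifferentiableAt ℝ (fun z => (c * η y) • ψ z) x :=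
      (hψ.differentiable one_ne_zero x).const_smul (c * η y)
    have hdη : DifferentiableAt ℝ (fun z => c * η z) x :=
      (hη.differentiable one_ne_zero x).const_mul c
    have hd2 : DifferentiableAt ℝ (fun z => (c * η z) • ψ y) x := hdη.smul_const _
    have e1 : divergence (fun z => (c * η y) • ψ z - (c * η z) • ψ y) x =
        divergence (fun z => (c * η y) • ψ z) x - divergence (fun z => (c * η z) • ψ y) x := by
      simp only [divergence]
      rw [fderiv_fun_sub hd1 hd2]
      simp [Finset.sum_sub_distrib]
    have e2 : divergence (fun z => (c * η y) • ψ z) x = c * η y * divergence ψ x := by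
      simp only [divergence]
      rw [fderiv_fun_const_smul (hψ.differentiable one_ne_zero x)]
      simp [Finset.mul_sum]
    rw [e1, e2, divergence_smul_const hdη, fderiv_const_mul (hη.differentiable one_ne_zero x)]
    simp [mul_assoc]
  have hset : ∫ y in Ω, η y = ∫ y, η y :=
    setIntegral_eq_integral_of_forall_compl_eq_zero hη0
  unfold nonlocalDiv
  rw [setIntegral_congr_fun hΩ.measurableSet hslice, integral_sub, integral_const_mul,
    integral_mul_const, integral_const_mul, hset,
    ContinuousLinearMap.integral_comp_comm _ hψi.integrableOn]
  · exact ((hηi.integrableOn.mul_const _).const_mul c)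
  · exact (((fderiv ℝ η x).integrable_comp hψi.integrableOn).const_mul c)

/-- For weights bounded below by a positive constant, the nonlocal norm controls the total
variation. -/
theorem exists_hasVariationLE_of_nlbvNorm_le {Ω : Set (Space N)} (hΩ : IsOpen Ω)
    (hne : Ω.Nonempty) (hbdd : Bornology.IsBounded Ω) {ω : Space N × Space N → ℝ}
    (hω : IsAdmissibleWeight Ω ω) {c : ℝ} (hc : 0 < c)
    (hcω : ∀ x ∈ Ω, ∀ y ∈ Ω, c ≤ ω (x, y)) (C : ℝ≥0) :
    ∃ M : ℝ, ∀ f : L1 Ω, nlbvNorm Ω ω f ≤ C → HasVariationLE Ω (Ω.indicator f) M := by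
  obtain ⟨x₀, hx₀⟩ := hne
  obtain ⟨η, hη, hηc, hηs, hη0, hη1, hηx⟩ := exists_contDiff_cutoff
    (isCompact_singleton (x := x₀)) hΩ (Set.singleton_subset_iff.mpr hx₀)
  have hI : 0 < ∫ y, η y := hη.continuous.integral_pos_of_hasCompactSupport_nonneg_nonzero
    hηc hη0 (x := x₀) (by rw [hηx x₀ rfl]; exact one_ne_zero)
  have hcd : Continuous (fderiv ℝ η) := hη.continuous_fderiv one_ne_zero
  obtain ⟨L, hL⟩ := (hηc.fderiv ℝ).exists_bound_of_continuous hcd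
  have hL0 : 0 ≤ L := (norm_nonneg _).trans (hL x₀)
  set V := volume.real Ω with hV
  -- Solve `c (∫η) ∫ f div ψ = ∫ f div_ω φ + c ∫ f ∇η · Ψ` for the variation term: the first summand
  -- is at most `C`, and `|∇η · Ψ| ≤ L V`.
  refine ⟨(C + c * (C * (L * V))) / (c * ∫ y, η y), fun f hf ψ hψ hψc hψs hψ1 => ?_⟩
  have hnorm : ‖f‖ ≤ C := by
    have : ‖f‖ₑ ≤ C := le_self_add.trans hf
    exact_mod_cast this
  have hNLTV : NLTV Ω ω f ≤ C := le_add_self.trans hf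
  have htest := isTestField_separated hΩ hω hc hcω hη hηc hηs
    (fun x => abs_le.mpr ⟨by linarith [hη0 x], hη1 x⟩) hψ hψc hψs hψ1
  have hle : ∫ x in Ω, f x * nonlocalDiv Ω ω (fun p => (-(c * η p.2) / ω p) • ψ p.1) x ≤ C := by
    have h1 := (le_iSup₂ (f := fun (φ : Space N × Space N → Space N) (_ : IsTestField Ω φ) =>
      ENNReal.ofReal (∫ x in Ω, f x * nonlocalDiv Ω ω φ x)) _ htest).trans hNLTV
    exact_mod_cast (ENNReal.ofReal_le_ofReal_iff C.coe_nonneg).mp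
      (by rwa [ENNReal.ofReal_coe_nnreal])
  have hfi : Integrable f (volume.restrict Ω) := L1.integrable_coeFn f
  set Ψ := ∫ y in Ω, ψ y with hΨ
  have hΨle : ‖Ψ‖ ≤ V := by
    have := norm_setIntegral_le_of_norm_le_const (μ := volume) (s := Ω) (C := 1)
      hbdd.measure_lt_top (fun x _ => hψ1 x)
    simpa using this
  have hcont := continuous_divergence hψ
  obtain ⟨B, hB⟩ := (HasCompactSupport.intro hψc fun x hx =>
    divergence_eq_zero_of_notMem_tsupport hx).exists_bound_of_continuous hcont
  have hi1 : Integrable (fun x => f x * divergence ψ x) (volume.restrict Ω) :=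
    hfi.mul_bdd hcont.aestronglyMeasurable (Eventually.of_forall hB)
  have hbd : ∀ x, ‖fderiv ℝ η x Ψ‖ ≤ L * V := fun x =>
    (ContinuousLinearMap.le_opNorm _ _).trans (by gcongr; exact hL x)
  have hi2 : Integrable (fun x => f x * fderiv ℝ η x Ψ) (volume.restrict Ω) :=
    hfi.mul_bdd (by fun_prop : Continuous fun x => fderiv ℝ η x Ψ).aestronglyMeasurable
      (Eventually.of_forall hbd)
  have hsplit : ∫ x in Ω, f x * nonlocalDiv Ω ω (fun p => (-(c * η p.2) / ω p) • ψ p.1) x =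
      c * (∫ y, η y) * (∫ x in Ω, f x * divergence ψ x) -
        c * ∫ x in Ω, f x * fderiv ℝ η x Ψ := by
    rw [← integral_const_mul (c * ∫ y, η y), ← integral_const_mul c (fun x => f x * _),
      ← integral_sub (hi1.const_mul _) (hi2.const_mul _)]
    refine integral_congr_ae (Eventually.of_forall fun x => ?_)
    simp only [nonlocalDiv_separated hΩ hω hc hcω hη hηc hηs hψ hψc hψs]
    ring
  have hrem : ∫ x in Ω, f x * fderiv ℝ η x Ψ ≤ C * (L * V) := by
    calc ∫ x in Ω, f x * fderiv ℝ η x Ψ ≤ ∫ x in Ω, ‖f x‖ * (L * V) := by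
          refine integral_mono hi2 (hfi.norm.mul_const _) fun x => ?_
          refine (Real.le_norm_self _).trans ?_
          rw [norm_mul]
          exact mul_le_mul_of_nonneg_left (hbd x) (norm_nonneg _)
      _ = ‖f‖ * (L * V) := by rw [integral_mul_const, L1.norm_eq_integral_norm]
      _ ≤ C * (L * V) := by gcongr
  have hind : ∫ x, Ω.indicator f x * divergence ψ x = ∫ x in Ω, f x * divergence ψ x := by
    rw [← integral_indicator hΩ.measurableSet]
    refine integral_congr_ae (Eventually.of_forall fun x => ?_)
    simp only [Set.indicator_mul_left]
  rw [hind, le_div_iff₀ (by positivity)]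
  nlinarith

/-! ### Lower semicontinuity -/

/-- The nonlocal divergence of a test field is measurable and bounded. -/
theorem IsTestField.nonlocalDiv_bounded {Ω : Set (Space N)} (hΩ : IsOpen Ω)
    (hbdd : Bornology.IsBounded Ω) {ω : Space N × Space N → ℝ} (hω : IsAdmissibleWeight Ω ω)
    {φ : Space N × Space N → Space N} (hφ : IsTestField Ω φ) :
    StronglyMeasurable (nonlocalDiv Ω ω φ) ∧ ∃ B, ∀ x, ‖nonlocalDiv Ω ω φ x‖ ≤ B := by
  -- Both `φ` and its swap are supported in `Ω ×ˢ Ω`, so `G` is `C¹` with compact support on the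
  -- whole space. Its divergence in the first variable is thus continuous and bounded.
  set G : Space N × Space N → Space N := fun p => ω p • (φ (p.2, p.1) - φ p) with hG
  set T := (Prod.swap ⁻¹' tsupport φ) ∪ tsupport φ with hT
  have hTc : IsCompact T :=
    ((Homeomorph.prodComm _ _).isCompact_preimage.mpr hφ.hasCompactSupport).union
      hφ.hasCompactSupport
  have hTs : T ⊆ Ω ×ˢ Ω := by
    rintro p (hp | hp)
    · exact ⟨(hφ.tsupport_subset hp).2, (hφ.tsupport_subset hp).1⟩
    · exact hφ.tsupport_subset hp
  have hts : tsupport G ⊆ T := by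
    refine closure_minimal (fun p hp => ?_) hTc.isClosed
    by_contra h
    rw [hT, Set.mem_union, not_or] at h
    have h1 : φ (p.2, p.1) = 0 := image_eq_zero_of_notMem_tsupport h.1
    have h2 : φ p = 0 := image_eq_zero_of_notMem_tsupport h.2
    exact hp (by simp [hG, h1, h2])
  have hGc : HasCompactSupport G := hTc.of_isClosed_subset (isClosed_tsupport _) hts
  have hGd : ContDiff ℝ 1 G := contDiff_iff_contDiffAt.mpr fun p => by
    by_cases hp : p ∈ Ω ×ˢ Ω
    · exact (hω.contDiffOn.contDiffAt ((hΩ.prod hΩ).mem_nhds hp)).smul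
        ((hφ.contDiff.comp (contDiff_snd.prodMk contDiff_fst)).sub hφ.contDiff).contDiffAt
    · exact (contDiffAt_const (c := (0 : Space N))).congr_of_eventuallyEq
        (notMem_tsupport_iff_eventuallyEq.mp fun h => hp (hTs (hts h)))
  set q : Space N × Space N → ℝ := fun p =>
    ∑ i : Fin N, (fderiv ℝ G p (EuclideanSpace.single i 1, 0)) i with hq
  have hcd : Continuous (fderiv ℝ G) := hGd.continuous_fderiv one_ne_zero
  have hqc : Continuous q := continuous_finsetSum _ fun i _ => by fun_prop
  have hqs : HasCompactSupport q := (hGc.fderiv ℝ).comp_left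
    (g := fun A : Space N × Space N →L[ℝ] Space N =>
      ∑ i : Fin N, (A (EuclideanSpace.single i 1, 0)) i) (by simp)
  obtain ⟨B, hB⟩ := hqs.exists_bound_of_continuous hqc
  have hdiv : nonlocalDiv Ω ω φ = fun x => ∫ y in Ω, q (x, y) := by
    funext x
    refine integral_congr_ae (Eventually.of_forall fun y => ?_)
    have h1 : HasFDerivAt (fun z : Space N => (z, y))
        (ContinuousLinearMap.inl ℝ (Space N) (Space N)) x := hasFDerivAt_prodMk_left x y
    have h2 := (hGd.differentiable one_ne_zero (x, y)).hasFDerivAt.comp x h1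
    have h3 : fderiv ℝ (fun z => ω (z, y) • (φ (y, z) - φ (z, y))) x =
        (fderiv ℝ G (x, y)).comp (ContinuousLinearMap.inl ℝ (Space N) (Space N)) := h2.fderiv
    simp [divergence, h3, hq]
  rw [hdiv]
  exact ⟨hqc.stronglyMeasurable.integral_prod_right', B * volume.real Ω, fun x =>
    norm_setIntegral_le_of_norm_le_const hbdd.measure_lt_top fun y _ => hB _⟩

theorem continuous_setIntegral_mul {Ω : Set (Space N)} {D : Space N → ℝ}
    (hD : StronglyMeasurable D) {B : ℝ} (hB : ∀ x, ‖D x‖ ≤ B) :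
    Continuous fun f : L1 Ω => ∫ x in Ω, f x * D x := by
  have hint : ∀ f : L1 Ω, Integrable (fun x => f x * D x) (volume.restrict Ω) := fun f =>
    (L1.integrable_coeFn f).mul_bdd hD.aestronglyMeasurable (Eventually.of_forall hB)
  have hB0 : 0 ≤ B := (norm_nonneg _).trans (hB 0)
  refine (LipschitzWith.of_dist_le_mul (K := B.toNNReal) fun f g => ?_).continuous
  rw [Real.coe_toNNReal _ hB0, dist_eq_norm, dist_eq_norm, ← integral_sub (hint f) (hint g),
    L1.norm_eq_integral_norm, ← integral_const_mul]
  refine norm_integral_le_of_norm_le ((L1.integrable_coeFn (f - g)).norm.const_mul B) ?_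
  filter_upwards [Lp.coeFn_sub f g] with x hx
  rw [hx, Pi.sub_apply, ← sub_mul, norm_mul, mul_comm]
  exact mul_le_mul_of_nonneg_right (hB x) (norm_nonneg _)

/-- The nonlocal total variation is lower semicontinuous along convergence in `L¹`. -/
theorem NLTV_le_of_tendsto {Ω : Set (Space N)} (hΩ : IsOpen Ω)
    (hbdd : Bornology.IsBounded Ω) {ω : Space N × Space N → ℝ} (hω : IsAdmissibleWeight Ω ω)
    {f : ℕ → L1 Ω} {g : L1 Ω} (hfg : Tendsto f atTop (𝓝 g)) {C : ℝ≥0∞}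
    (hC : ∀ n, NLTV Ω ω (f n) ≤ C) : NLTV Ω ω g ≤ C := by
  -- A bounded divergence makes each tested integral `L¹`-continuous in the function; a supremum of
  -- such functionals is lower semicontinuous.
  refine iSup₂_le fun φ hφ => ?_
  obtain ⟨hm, B, hB⟩ := hφ.nonlocalDiv_bounded hΩ hbdd hω
  refine le_of_tendsto (ENNReal.tendsto_ofReal
    (((continuous_setIntegral_mul hm hB).tendsto g).comp hfg))
    (Eventually.of_forall fun n => ?_)
  exact (le_iSup₂ (f := fun (φ : Space N × Space N → Space N) (_ : IsTestField Ω φ) =>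
    ENNReal.ofReal (∫ x in Ω, f n x * nonlocalDiv Ω ω φ x)) φ hφ).trans (hC n)

/-! ### Compactness -/

/-- Rellich's theorem for functions of bounded variation on bounded Lipschitz domains. -/
theorem totallyBounded_range_of_hasVariationLE {Ω : Set (Space N)} (hΩ : IsOpen Ω)
    (hlip : HasLipschitzBoundary Ω) (hbdd : Bornology.IsBounded Ω) {u : ℕ → L1 Ω} {C M : ℝ}
    (hC : ∀ n, ‖u n‖ ≤ C) (hM : ∀ n, HasVariationLE Ω (Ω.indicator (u n)) M) :
    TotallyBounded (Set.range u) := by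
  rw [Metric.totallyBounded_iff]
  intro ε hε
  -- The estimate is applied to differences, whose variation is at most `M + M`.
  obtain ⟨D, c, hc, hest⟩ := hlip.exists_setIntegral_abs_le hΩ hbdd (M + M) (half_pos hε)
  have hi : ∀ n, Integrable (Ω.indicator (u n)) := fun n => integrable_indicator_L1 hΩ _
  -- The averages form a bounded sequence in a finite-dimensional space; a finite `δ`-net of its
  -- range yields an `ε`-net of the functions.
  set a : ℕ → (D → ℝ) := fun n d => ∫ x in (d : Set (Space N)), Ω.indicator (u n) x with ha
  have hC0 : 0 ≤ C := (norm_nonneg _).trans (hC 0)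
  have hnorm : ∀ n, ‖a n‖ ≤ C := fun n => by
    refine (pi_norm_le_iff_of_nonneg hC0).mpr fun d => ?_
    calc ‖a n d‖ ≤ ∫ x in (d : Set (Space N)), ‖Ω.indicator (u n) x‖ :=
          norm_integral_le_integral_norm _
      _ ≤ ∫ x, ‖Ω.indicator (u n) x‖ :=
          setIntegral_le_integral (hi n).norm (Eventually.of_forall fun _ => norm_nonneg _)
      _ = ‖u n‖ := by
          simp only [norm_indicator_eq_indicator_norm]
          rw [integral_indicator hΩ.measurableSet, L1.norm_eq_integral_norm]
      _ ≤ C := hC n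
  have htb : TotallyBounded (Set.range a) :=
    (isCompact_closedBall (0 : D → ℝ) C).totallyBounded.subset (by
      rintro _ ⟨n, rfl⟩
      simpa using hnorm n)
  set δ := ε / (2 * (c * D.card + 1)) with hδ
  have hδ0 : 0 < δ := by positivity
  obtain ⟨t, hts, ht, hcover⟩ := Metric.finite_approx_of_totallyBounded htb δ hδ0
  choose! k hk using fun y (hy : y ∈ t) => Set.mem_range.mp (hts hy)
  refine ⟨(u ∘ k) '' t, ht.image _, ?_⟩
  rintro _ ⟨n, rfl⟩
  obtain ⟨y, hy, hny⟩ := Set.mem_iUnion₂.mp (hcover ⟨n, rfl⟩)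
  refine Set.mem_iUnion₂.mpr ⟨u (k y), ⟨y, hy, rfl⟩, ?_⟩
  have hdist : dist (a n) (a (k y)) < δ := by rw [hk y hy]; exact hny
  have hkey := hest _ ((hi n).sub (hi (k y))) ((hM n).sub (hM (k y)) (hi n) (hi (k y)))
  have hleft : ∫ x in Ω, |(Ω.indicator (u n) - Ω.indicator (u (k y))) x| =
      dist (u n) (u (k y)) := by
    rw [dist_eq_norm, L1.norm_eq_integral_norm]
    refine integral_congr_ae ?_
    filter_upwards [Lp.coeFn_sub (u n) (u (k y)), ae_restrict_mem hΩ.measurableSet] with x hx hxΩ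
    rw [hx, Pi.sub_apply, Pi.sub_apply, Set.indicator_of_mem hxΩ, Set.indicator_of_mem hxΩ,
      Real.norm_eq_abs]
  have hright : ∑ d ∈ D, |∫ x in d, (Ω.indicator (u n) - Ω.indicator (u (k y))) x| ≤
      D.card * δ := by
    rw [← nsmul_eq_mul]
    refine Finset.sum_le_card_nsmul _ _ _ fun d hd => ?_
    have := (dist_le_pi_dist (a n) (a (k y)) ⟨d, hd⟩).trans hdist.le
    rw [Real.dist_eq] at this
    rwa [integral_sub' (hi n).integrableOn (hi (k y)).integrableOn]
  rw [hleft] at hkey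
  rw [Metric.mem_ball]
  have h1 : c * ∑ d ∈ D, |∫ x in d, (Ω.indicator (u n) - Ω.indicator (u (k y))) x| ≤
      c * (D.card * δ) := by gcongr
  have h2 : c * (D.card * δ) < ε / 2 := by
    have : (c * D.card + 1) * δ = ε / 2 := by
      rw [hδ]; field_simp
    linarith
  linarith

end NonlocalBV

theorem mainTheorem12 {N : ℕ} (Ω : Set (NonlocalBV.Space N)) (hΩ_open : IsOpen Ω)
    (hΩ_nonempty : Ω.Nonempty) (hΩ_bounded : Bornology.IsBounded Ω)
    (hΩ_lip : NonlocalBV.HasLipschitzBoundary Ω)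
    (ω : NonlocalBV.Space N × NonlocalBV.Space N → ℝ)
    (hω : NonlocalBV.IsAdmissibleWeight Ω ω)
    (hω_below : ∃ c : ℝ, 0 < c ∧ ∀ x ∈ Ω, ∀ y ∈ Ω, c ≤ ω (x, y))
    (u : ℕ → NonlocalBV.L1 Ω) (hu_mem : ∀ n, u n ∈ NonlocalBV.NLBV Ω ω)
    (hu_bdd : ∃ C : ℝ≥0, ∀ n, NonlocalBV.nlbvNorm Ω ω (u n) ≤ C) :
    ∃ n : ℕ → ℕ, StrictMono n ∧ ∃ u' ∈ NonlocalBV.NLBV Ω ω,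
      Tendsto (fun k => u (n k)) atTop (𝓝 u') := by
  obtain ⟨c, hc, hcω⟩ := hω_below
  obtain ⟨C, hC⟩ := hu_bdd
  obtain ⟨M, hM⟩ := NonlocalBV.exists_hasVariationLE_of_nlbvNorm_le hΩ_open hΩ_nonempty
    hΩ_bounded hω hc hcω C
  have hnorm : ∀ n, ‖u n‖ ≤ C := fun n => by
    have : ‖u n‖ₑ ≤ C := le_self_add.trans (hC n)
    exact_mod_cast this
  have htb := NonlocalBV.totallyBounded_range_of_hasVariationLE hΩ_open hΩ_lip hΩ_bounded hnorm
    fun n => hM (u n) (hC n)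
  -- By completeness of `L¹`, the closure of the totally bounded range is compact.
  obtain ⟨u', -, n, hn, hlim⟩ := (htb.closure.isCompact_of_isClosed isClosed_closure).tendsto_subseq
    fun k => subset_closure (Set.mem_range_self (f := u) k)
  exact ⟨n, hn, u', (NonlocalBV.NLTV_le_of_tendsto hΩ_open hΩ_bounded hω hlim
    fun k => le_add_self.trans (hC (n k))).trans_lt ENNReal.coe_lt_top, hlim⟩
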